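/- Let $d\ge 1$, let $\Omega\subset\mathbb{R}^d$ be an open set that fits inside a strip of finite width $L$ (the region between two parallel hyperplanes at distance $L$), let $1<p<\infty$ and $\frac1p+\frac1q=1$, and let $f\in L^q(\Omega)$ and $g\in W^{1,p}(\Omega)$. Let $W_0^{1,p}(\Omega)$ be the closure of $C_c^\infty(\Omega)$ in $W^{1,p}(\Omega)$, and consider the $p$-Laplace energy $$J(u)=\frac1p\int_\Omega\|\nabla(u+g)\|_2^p\,dx-\int_\Omega f u\,dx .$$ Then there is a unique $u\in W_0^{1,p}(\Omega)$ that minimizes $J$ over $W_0^{1,p}(\Omega)$. More generally, for every closed linear subspace $V\subset W_0^{1,p}(\Omega)$ there is a unique $u\in V$ that minimizes $J$ over $V$. -/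

import Mathlib

open MeasureTheory Set
open scoped ENNReal ContDiff

/-- A test function on `Ω`: a real-valued `C^∞` function whose support is compact and contained
in `Ω`. -/
structure IsTestFunction {d : ℕ} (Ω : Set (EuclideanSpace ℝ (Fin d)))
    (φ : EuclideanSpace ℝ (Fin d) → ℝ) : Prop where
  contDiff : ContDiff ℝ ∞ φ
  hasCompactSupport : HasCompactSupport φ
  tsupport_subset : tsupport φ ⊆ Ω

/-- The partial derivative `∂ᵢ φ (x)`. -/
noncomputable def partialDeriv {d : ℕ} (i : Fin d) (φ : EuclideanSpace ℝ (Fin d) → ℝ)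
    (x : EuclideanSpace ℝ (Fin d)) : ℝ :=
  fderiv ℝ φ x (EuclideanSpace.single i 1)

/-- The vector field `G` is the weak gradient of `u` on `Ω`:
`∫_Ω u ∂ᵢφ = - ∫_Ω Gᵢ φ` for every test function `φ` and every `i`. It is only used for `u` and
`G` in `L^p(Ω)`, where all these integrals converge. -/
def HasWeakGradient {d : ℕ} (Ω : Set (EuclideanSpace ℝ (Fin d)))
    (u : EuclideanSpace ℝ (Fin d) → ℝ)
    (G : EuclideanSpace ℝ (Fin d) → EuclideanSpace ℝ (Fin d)) : Prop :=
  ∀ φ : EuclideanSpace ℝ (Fin d) → ℝ, IsTestFunction Ω φ → ∀ i : Fin d,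
    ∫ x in Ω, u x * partialDeriv i φ x = - ∫ x in Ω, G x i * φ x

theorem IsTestFunction.continuous_partialDeriv {d : ℕ} {Ω : Set (EuclideanSpace ℝ (Fin d))}
    {φ : EuclideanSpace ℝ (Fin d) → ℝ} (h : IsTestFunction Ω φ) (i : Fin d) :
    Continuous (partialDeriv i φ) :=
  (h.contDiff.continuous_fderiv (by simp)).clm_apply continuous_const

theorem IsTestFunction.hasCompactSupport_partialDeriv {d : ℕ}
    {Ω : Set (EuclideanSpace ℝ (Fin d))} {φ : EuclideanSpace ℝ (Fin d) → ℝ}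
    (h : IsTestFunction Ω φ) (i : Fin d) : HasCompactSupport (partialDeriv i φ) :=
  h.hasCompactSupport.fderiv_apply (𝕜 := ℝ) _

theorem integrable_Lp_mul_of_hasCompactSupport {d : ℕ} {Ω : Set (EuclideanSpace ℝ (Fin d))}
    {p : ℝ≥0∞} [hp : Fact (1 ≤ p)] {u ψ : EuclideanSpace ℝ (Fin d) → ℝ}
    (hu : MemLp u p (volume.restrict Ω)) (hψ : Continuous ψ) (hc : HasCompactSupport ψ) :
    Integrable (fun x => u x * ψ x) (volume.restrict Ω) := by
  have h1 : LocallyIntegrable u (volume.restrict Ω) := hu.locallyIntegrable hp.out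
  have h2 := h1.integrable_smul_right_of_hasCompactSupport hψ hc
  simpa [smul_eq_mul] using h2

theorem memLp_coord {d : ℕ} {Ω : Set (EuclideanSpace ℝ (Fin d))} {p : ℝ≥0∞}
    {G : EuclideanSpace ℝ (Fin d) → EuclideanSpace ℝ (Fin d)}
    (hG : MemLp G p (volume.restrict Ω)) (i : Fin d) :
    MemLp (fun x => G x i) p (volume.restrict Ω) :=
  (EuclideanSpace.proj i : EuclideanSpace ℝ (Fin d) →L[ℝ] ℝ).comp_memLp' hG

/-- The Sobolev space `W^{1,p}(Ω)`. An element is a function in `L^p(Ω)` together with its weak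
gradient, which has to lie in `L^p(Ω; ℝ^d)`; the gradient is determined by the function
(see `W1p.ext_fn`). The norm inherited from the product is
`max (‖u‖_{L^p}, ‖∇u‖_{L^p})`, which is equivalent to the usual `W^{1,p}` norm. -/
noncomputable def W1p {d : ℕ} (Ω : Set (EuclideanSpace ℝ (Fin d))) (p : ℝ≥0∞)
    [hp : Fact (1 ≤ p)] :
    Submodule ℝ (Lp ℝ p (volume.restrict Ω) ×
      Lp (EuclideanSpace ℝ (Fin d)) p (volume.restrict Ω)) where
  carrier := {w | HasWeakGradient Ω w.1 w.2}
  zero_mem' := by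
    intro φ hφ i
    have h1 : ∫ x in Ω, (0 : Lp ℝ p (volume.restrict Ω)) x * partialDeriv i φ x = 0 := by
      apply integral_eq_zero_of_ae
      filter_upwards [Lp.coeFn_zero ℝ p (volume.restrict Ω)] with x hx
      rw [hx]
      simp
    have h2 : ∫ x in Ω,
        (0 : Lp (EuclideanSpace ℝ (Fin d)) p (volume.restrict Ω)) x i * φ x = 0 := by
      apply integral_eq_zero_of_ae
      filter_upwards [Lp.coeFn_zero (EuclideanSpace ℝ (Fin d)) p (volume.restrict Ω)] with x hx
      rw [hx]
      simp
    exact h1.trans (by rw [← neg_eq_zero] at h2; exact h2.symm)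
  add_mem' := by
    rintro ⟨u, G⟩ ⟨v, H⟩ hu hv φ hφ i
    have e1 : ∫ x in Ω, (u + v) x * partialDeriv i φ x
        = (∫ x in Ω, u x * partialDeriv i φ x) + ∫ x in Ω, v x * partialDeriv i φ x := by
      rw [← integral_add
        (integrable_Lp_mul_of_hasCompactSupport (Lp.memLp u) (hφ.continuous_partialDeriv i)
          (hφ.hasCompactSupport_partialDeriv i))
        (integrable_Lp_mul_of_hasCompactSupport (Lp.memLp v) (hφ.continuous_partialDeriv i)
          (hφ.hasCompactSupport_partialDeriv i))]
      apply integral_congr_ae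
      filter_upwards [Lp.coeFn_add u v] with x hx
      rw [hx]
      simp [add_mul]
    have e2 : ∫ x in Ω, (G + H) x i * φ x
        = (∫ x in Ω, G x i * φ x) + ∫ x in Ω, H x i * φ x := by
      rw [← integral_add
        (integrable_Lp_mul_of_hasCompactSupport (memLp_coord (Lp.memLp G) i)
          hφ.contDiff.continuous hφ.hasCompactSupport)
        (integrable_Lp_mul_of_hasCompactSupport (memLp_coord (Lp.memLp H) i)
          hφ.contDiff.continuous hφ.hasCompactSupport)]
      apply integral_congr_ae
      filter_upwards [Lp.coeFn_add G H] with x hx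
      rw [hx]
      simp [add_mul]
    have h1 := hu φ hφ i
    have h2 := hv φ hφ i
    simp only at h1 h2
    simp only [Prod.mk_add_mk]
    rw [e1, e2, h1, h2]
    ring
  smul_mem' := by
    rintro c ⟨u, G⟩ hu φ hφ i
    have e1 : ∫ x in Ω, (c • u) x * partialDeriv i φ x
        = c * ∫ x in Ω, u x * partialDeriv i φ x := by
      rw [← integral_const_mul]
      apply integral_congr_ae
      filter_upwards [Lp.coeFn_smul c u] with x hx
      rw [hx]
      simp [mul_assoc]
    have e2 : ∫ x in Ω, (c • G) x i * φ x = c * ∫ x in Ω, G x i * φ x := by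
      rw [← integral_const_mul]
      apply integral_congr_ae
      filter_upwards [Lp.coeFn_smul c G] with x hx
      rw [hx]
      simp [mul_assoc]
    have h1 := hu φ hφ i
    simp only at h1
    simp only [Prod.smul_mk]
    rw [e1, e2, h1]
    ring

namespace W1p

/-- The function underlying an element of `W^{1,p}(Ω)`. -/
noncomputable def fn {d : ℕ} {Ω : Set (EuclideanSpace ℝ (Fin d))} {p : ℝ≥0∞} [Fact (1 ≤ p)]
    (u : W1p Ω p) : Lp ℝ p (volume.restrict Ω) :=
  u.1.1

/-- The weak gradient of an element of `W^{1,p}(Ω)`. -/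
noncomputable def grad {d : ℕ} {Ω : Set (EuclideanSpace ℝ (Fin d))} {p : ℝ≥0∞} [Fact (1 ≤ p)]
    (u : W1p Ω p) : Lp (EuclideanSpace ℝ (Fin d)) p (volume.restrict Ω) :=
  u.1.2

/-- On an open set, an element of `W^{1,p}(Ω)` is determined by its underlying function. -/
theorem ext_fn {d : ℕ} {Ω : Set (EuclideanSpace ℝ (Fin d))} (hΩ : IsOpen Ω) {p : ℝ≥0∞}
    [hp : Fact (1 ≤ p)] {u v : W1p Ω p} (h : W1p.fn u = W1p.fn v) : u = v := by
  have key : ∀ i : Fin d, ∀ᵐ x ∂(volume : Measure (EuclideanSpace ℝ (Fin d))),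
      x ∈ Ω → W1p.grad u x i - W1p.grad v x i = 0 := by
    intro i
    have hu := memLp_coord (Lp.memLp (W1p.grad u)) i
    have hv := memLp_coord (Lp.memLp (W1p.grad v)) i
    apply hΩ.ae_eq_zero_of_integral_contDiff_smul_eq_zero
    · intro x hx
      obtain ⟨K, hK, hxK, hKΩ⟩ : ∃ K, IsCompact K ∧ K ∈ nhds x ∧ K ⊆ Ω := by
        obtain ⟨K, hK1, hK2, hK3⟩ := local_compact_nhds (hΩ.mem_nhds hx)
        exact ⟨K, hK3, hK1, hK2⟩
      refine ⟨K, mem_nhdsWithin_of_mem_nhds hxK, ?_⟩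
      have := (((hu.sub hv).locallyIntegrable hp.out).integrableOn_isCompact hK)
      rw [IntegrableOn, Measure.restrict_restrict hK.measurableSet,
        inter_eq_left.mpr hKΩ] at this
      exact this
    · intro φ hφ hc hs
      have ht : IsTestFunction Ω φ := ⟨hφ, hc, hs⟩
      have h1 : ∫ x in Ω, W1p.fn u x * partialDeriv i φ x = - ∫ x in Ω, W1p.grad u x i * φ x :=
        u.2 φ ht i
      have h2 : ∫ x in Ω, W1p.fn v x * partialDeriv i φ x = - ∫ x in Ω, W1p.grad v x i * φ x :=
        v.2 φ ht i
      rw [h] at h1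
      have h3 : ∫ x in Ω, W1p.grad u x i * φ x = ∫ x in Ω, W1p.grad v x i * φ x := by linarith
      have h4 : ∫ x in Ω, φ x • (W1p.grad u x i - W1p.grad v x i) = 0 := by
        have : ∀ x, φ x • (W1p.grad u x i - W1p.grad v x i) = W1p.grad u x i * φ x - W1p.grad v x i * φ x := by
          intro x; simp only [smul_eq_mul]; ring
        simp_rw [this]
        rw [integral_sub
          (integrable_Lp_mul_of_hasCompactSupport hu ht.contDiff.continuous hc)
          (integrable_Lp_mul_of_hasCompactSupport hv ht.contDiff.continuous hc), h3, sub_self]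
      rw [← h4]
      refine (setIntegral_eq_integral_of_forall_compl_eq_zero fun x hx => ?_).symm
      have : φ x = 0 := image_eq_zero_of_notMem_tsupport fun hx' => hx (hs hx')
      simp [this]
  apply Subtype.ext
  apply Prod.ext
  · exact h
  · apply Lp.ext
    rw [Filter.EventuallyEq, ae_restrict_iff' hΩ.measurableSet]
    filter_upwards [ae_all_iff.mpr key] with x hx hxΩ
    ext i
    exact sub_eq_zero.mp (hx i hxΩ)

end W1p

/-- The elements of `W^{1,p}(Ω)` that are (a.e. equal to) test functions: `C_c^∞(Ω)`, seen as a
subspace of `W^{1,p}(Ω)`. -/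
noncomputable def testSubspace {d : ℕ} (Ω : Set (EuclideanSpace ℝ (Fin d))) (p : ℝ≥0∞)
    [hp : Fact (1 ≤ p)] : Submodule ℝ (W1p Ω p) where
  carrier := {u | ∃ φ, IsTestFunction Ω φ ∧ W1p.fn u =ᵐ[volume.restrict Ω] φ}
  zero_mem' := by
    refine ⟨0, ⟨contDiff_const, HasCompactSupport.zero, by simp [tsupport]⟩, ?_⟩
    exact Lp.coeFn_zero ℝ p (volume.restrict Ω)
  add_mem' := by
    rintro u v ⟨φ, hφ, hu⟩ ⟨ψ, hψ, hv⟩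
    refine ⟨φ + ψ, ⟨hφ.contDiff.add hψ.contDiff,
      hφ.hasCompactSupport.add hψ.hasCompactSupport, ?_⟩, ?_⟩
    · exact (tsupport_add φ ψ).trans (union_subset hφ.tsupport_subset hψ.tsupport_subset)
    · exact (Lp.coeFn_add (W1p.fn u) (W1p.fn v)).trans (hu.add hv)
  smul_mem' := by
    rintro c u ⟨φ, hφ, hu⟩
    refine ⟨c • φ, ⟨contDiff_const.smul hφ.contDiff, hφ.hasCompactSupport.smul_left, ?_⟩, ?_⟩
    · exact (closure_mono (Function.support_const_smul_subset c φ)).trans hφ.tsupport_subset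
    · exact (Lp.coeFn_smul c (W1p.fn u)).trans (hu.const_smul c)

/-- The space `W_0^{1,p}(Ω)`: the closure of `C_c^∞(Ω)` in `W^{1,p}(Ω)`. -/
noncomputable def W10p {d : ℕ} (Ω : Set (EuclideanSpace ℝ (Fin d))) (p : ℝ≥0∞)
    [Fact (1 ≤ p)] : Submodule ℝ (W1p Ω p) :=
  (testSubspace Ω p).topologicalClosure

/-- The set `Ω` fits inside a strip of width `L`, the closed region between two parallel
hyperplanes (with unit normal `e`) at distance `L`. -/
def FitsInStrip {d : ℕ} (Ω : Set (EuclideanSpace ℝ (Fin d))) (L : ℝ) : Prop :=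
  ∃ (e : EuclideanSpace ℝ (Fin d)) (a : ℝ), ‖e‖ = 1 ∧
    ∀ x ∈ Ω, a ≤ inner ℝ e x ∧ inner ℝ e x ≤ a + L

/-- The `p`-Laplace energy with forcing `f` and boundary data `g`,
`J(u) = (1/p) ∫_Ω ‖∇(u + g)‖₂^p - ∫_Ω f u`. -/
noncomputable def pLaplaceEnergy {d : ℕ} {Ω : Set (EuclideanSpace ℝ (Fin d))} {p q : ℝ≥0∞}
    [Fact (1 ≤ p)] (f : Lp ℝ q (volume.restrict Ω)) (g u : W1p Ω p) : ℝ :=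
  1 / p.toReal * (∫ x in Ω, ‖W1p.grad (u + g) x‖ ^ p.toReal) - ∫ x in Ω, f x * W1p.fn u x

/-!
The proof is the direct method with norm convergence in place of weak compactness.

The function `‖·‖^p` on `ℝ^d` is uniformly convex in the following sense: for each `ε > 0` there
is `D` with `‖a - b‖^p ≤ ε (‖a‖^p + ‖b‖^p) + D δ(a, b)`, where
`δ(a, b) = (‖a‖^p + ‖b‖^p) / 2 - ‖(a + b) / 2‖^p`. This follows from strict convexity, homogeneity
and compactness of the unit sphere (`exists_norm_sub_rpow_le`), for all `1 < p < ∞` without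
distinguishing `p ≤ 2` and `p ≥ 2`, and it can be integrated to the same inequality for the `L^p`
norm (`MeasureTheory.Lp.exists_norm_sub_rpow_le`).

Integrating `|φ|^p ∂ₑ(⟪e, x⟫ - a)` by parts gives the Poincaré inequality on the strip
(`FitsInStrip.exists_norm_fn_le`). Hence `J` is coercive on `W_0^{1,p}(Ω)`: it bounds
`‖∇(u + g)‖_p` up to a constant. If `u` and `v` are near-minimizers of `J` over `V`, then
`J ((u + v) / 2)` is at least the infimum, so the convexity defect of `∇(u + g)` and `∇(v + g)` is
small. By uniform convexity `‖∇(u - v)‖_p` is small, and by Poincaré so is the distance of `u` and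
`v` (`existsUnique_normRpowEnergy_le`). Minimizing sequences are thus Cauchy and converge in `V`,
because `W^{1,p}(Ω)` is complete (`W1p.completeSpace`), and any two minimizers are equal.
-/

/-! ### Minimizers of well-posed problems -/

/-- A continuous functional on a closed set of a complete space has exactly one minimizer if its
near-minimizers are close to each other: a minimizing sequence is then Cauchy. No compactness or
weak topology is involved. -/
theorem existsUnique_isMinOn_of_dist_le {X : Type*} [MetricSpace X] [CompleteSpace X]
    {s : Set X} (hs : IsClosed s) (hne : s.Nonempty) {J : X → ℝ} (hJ : Continuous J)
    (hb : BddBelow (J '' s))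
    (h : ∀ ε > 0, ∃ δ > 0, ∀ u ∈ s, ∀ v ∈ s, J u ≤ sInf (J '' s) + δ → J v ≤ sInf (J '' s) + δ →
      dist u v ≤ ε) :
    ∃! u, u ∈ s ∧ ∀ v ∈ s, J u ≤ J v := by
  set m := sInf (J '' s) with hm
  have hle : ∀ v ∈ s, m ≤ J v := fun v hv => csInf_le hb (mem_image_of_mem J hv)
  have hex : ∀ n : ℕ, ∃ u ∈ s, J u < m + 1 / ((n : ℝ) + 1) := by
    intro n
    obtain ⟨_, ⟨u, hu, rfl⟩, h2⟩ := exists_lt_of_csInf_lt (hne.image J)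
      (show sInf (J '' s) < m + 1 / ((n : ℝ) + 1) by
        rw [← hm]; linarith [Nat.one_div_pos_of_nat (α := ℝ) (n := n)])
    exact ⟨u, hu, h2⟩
  choose u hu hJu using hex
  have hcau : CauchySeq u := by
    rw [Metric.cauchySeq_iff]
    intro ε hε
    obtain ⟨δ, hδ, hd⟩ := h (ε / 2) (by positivity)
    obtain ⟨N, hN⟩ := exists_nat_one_div_lt hδ
    have key : ∀ n ≥ N, J (u n) ≤ m + δ := fun n hn => by
      have := hJu n
      have h1 := Nat.one_div_le_one_div (α := ℝ) hn
      linarith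
    exact ⟨N, fun a ha b hb => by
      linarith [hd _ (hu a) _ (hu b) (key a ha) (key b hb)]⟩
  obtain ⟨w, hw⟩ := cauchySeq_tendsto_of_complete hcau
  have hws : w ∈ s := hs.mem_of_tendsto hw (Filter.Eventually.of_forall hu)
  have hJw : J w ≤ m := by
    have h1 := tendsto_one_div_add_atTop_nhds_zero_nat (𝕜 := ℝ)
    have h2 := (hJ.tendsto w).comp hw
    have h3 := h1.const_add m
    rw [add_zero] at h3
    exact le_of_tendsto_of_tendsto' h2 h3 fun n => (hJu n).le
  refine ⟨w, ⟨hws, fun v hv => hJw.trans (hle v hv)⟩, ?_⟩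
  rintro v ⟨hv, hmin⟩
  apply eq_of_dist_eq_zero
  refine le_antisymm (le_of_forall_pos_le_add fun ε hε => ?_) dist_nonneg
  obtain ⟨δ, hδ, hd⟩ := h ε hε
  rw [zero_add]
  exact hd v hv w hws (by linarith [hmin w hws]) (by linarith)

/-! ### Uniform convexity of powers of the norm -/

/-- The midpoint convexity defect `(‖a‖^r + ‖b‖^r) / 2 - ‖(a + b) / 2‖^r` of the function
`‖·‖^r`. -/
noncomputable def convexityDefect {E : Type*} [NormedAddCommGroup E] [NormedSpace ℝ E] (r : ℝ)
    (a b : E) : ℝ :=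
  (‖a‖ ^ r + ‖b‖ ^ r) / 2 - ‖(1 / 2 : ℝ) • (a + b)‖ ^ r

section Pointwise

variable {E : Type*} [NormedAddCommGroup E] [NormedSpace ℝ E] {r : ℝ}

theorem norm_half_smul_add_le (a b : E) : ‖(1 / 2 : ℝ) • (a + b)‖ ≤ 1 / 2 * ‖a‖ + 1 / 2 * ‖b‖ := by
  rw [norm_smul, Real.norm_of_nonneg (by norm_num)]
  linarith [norm_add_le a b]

theorem convexityDefect_nonneg (hr : 1 ≤ r) (a b : E) : 0 ≤ convexityDefect r a b := by
  have h1 : ‖(1 / 2 : ℝ) • (a + b)‖ ^ r ≤ (1 / 2 * ‖a‖ + 1 / 2 * ‖b‖) ^ r :=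
    Real.rpow_le_rpow (norm_nonneg _) (norm_half_smul_add_le a b) (by linarith)
  have h2 := (convexOn_rpow hr).2 (norm_nonneg a) (norm_nonneg b)
    (by norm_num : (0 : ℝ) ≤ 1 / 2) (by norm_num : (0 : ℝ) ≤ 1 / 2) (by norm_num)
  simp only [smul_eq_mul] at h2
  unfold convexityDefect
  linarith

theorem convexityDefect_pos [StrictConvexSpace ℝ E] (hr : 1 < r) {a b : E} (hab : a ≠ b) :
    0 < convexityDefect r a b := by
  unfold convexityDefect
  by_cases hn : ‖a‖ = ‖b‖
  · have h1 := (norm_midpoint_lt_iff hn).2 hab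
    have h2 := Real.rpow_lt_rpow (norm_nonneg _) h1 (by linarith : 0 < r)
    rw [← hn]
    linarith
  · have h1 : ‖(1 / 2 : ℝ) • (a + b)‖ ^ r ≤ (1 / 2 * ‖a‖ + 1 / 2 * ‖b‖) ^ r :=
      Real.rpow_le_rpow (norm_nonneg _) (norm_half_smul_add_le a b) (by linarith)
    have h2 := (strictConvexOn_rpow hr).2 (norm_nonneg a) (norm_nonneg b) hn
      (by norm_num : (0 : ℝ) < 1 / 2) (by norm_num : (0 : ℝ) < 1 / 2) (by norm_num)
    simp only [smul_eq_mul] at h2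
    linarith

theorem norm_smul_rpow_of_nonneg {t : ℝ} (ht : 0 ≤ t) (a : E) :
    ‖t • a‖ ^ r = t ^ r * ‖a‖ ^ r := by
  rw [norm_smul, Real.norm_of_nonneg ht, Real.mul_rpow ht (norm_nonneg a)]

theorem convexityDefect_smul {t : ℝ} (ht : 0 ≤ t) (a b : E) :
    convexityDefect r (t • a) (t • b) = t ^ r * convexityDefect r a b := by
  unfold convexityDefect
  rw [← smul_add, smul_comm, norm_smul_rpow_of_nonneg ht, norm_smul_rpow_of_nonneg ht,
    norm_smul_rpow_of_nonneg ht]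
  ring

theorem continuous_convexityDefect (hr : 0 ≤ r) :
    Continuous fun z : E × E => convexityDefect r z.1 z.2 := by
  unfold convexityDefect
  have h (f : E × E → E) (hf : Continuous f) : Continuous fun z => ‖f z‖ ^ r :=
    hf.norm.rpow_const fun _ => Or.inr hr
  exact (((h _ continuous_fst).add (h _ continuous_snd)).div_const 2).sub
    (h _ ((continuous_fst.add continuous_snd).const_smul (1 / 2 : ℝ)))

/-- A pointwise form of uniform convexity of `‖·‖^r`, valid for all `r > 1` at once: up to a small
multiple of `‖a‖^r + ‖b‖^r`, the distance of `a` and `b` is controlled by the convexity defect.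
Both sides are homogeneous of degree `r`, so it is enough to look at the unit sphere of `E × E`;
the defect is bounded below on the compact part of it where the `ε`-term does not already suffice. -/
theorem exists_norm_sub_rpow_le [FiniteDimensional ℝ E] [StrictConvexSpace ℝ E] (hr : 1 < r)
    {ε : ℝ} (hε : 0 < ε) :
    ∃ C : ℝ, 0 ≤ C ∧ ∀ a b : E,
      ‖a - b‖ ^ r ≤ ε * (‖a‖ ^ r + ‖b‖ ^ r) + C * convexityDefect r a b := by
  have hr0 : 0 < r := by linarith
  have : ProperSpace (E × E) := FiniteDimensional.proper ℝ _
  have hcont (f : E × E → E) (hf : Continuous f) : Continuous fun z => ‖f z‖ ^ r :=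
    hf.norm.rpow_const fun _ => Or.inr hr0.le
  let K : Set (E × E) := Metric.sphere 0 1 ∩
    {z | ε * (‖z.1‖ ^ r + ‖z.2‖ ^ r) ≤ ‖z.1 - z.2‖ ^ r}
  have hK : IsCompact K := (isCompact_sphere 0 1).inter_right <|
    isClosed_le (((hcont _ continuous_fst).add (hcont _ continuous_snd)).const_mul ε)
      (hcont _ (continuous_fst.sub continuous_snd))
  have hpos : ∀ z ∈ K, 0 < convexityDefect r z.1 z.2 := by
    rintro ⟨a, b⟩ ⟨h1, h2⟩
    apply convexityDefect_pos hr
    intro hab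
    obtain rfl : a = b := hab
    -- On the diagonal the constraint reads `2 ε ≤ 0`.
    simp only [mem_ofPred_eq, sub_self, norm_zero, Real.zero_rpow hr0.ne'] at h2
    have h3 : ‖a‖ = 1 := by simpa using h1
    rw [h3, Real.one_rpow] at h2
    linarith
  obtain ⟨δ, hδ, hδK⟩ := hK.exists_forall_le' (continuous_convexityDefect hr0.le).continuousOn hpos
  refine ⟨2 ^ r / δ, by positivity, fun a b => ?_⟩
  have unit : ∀ z : E × E, ‖z‖ = 1 → ‖z.1 - z.2‖ ^ r ≤
      ε * (‖z.1‖ ^ r + ‖z.2‖ ^ r) + 2 ^ r / δ * convexityDefect r z.1 z.2 := by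
    intro z hz
    by_cases h : ε * (‖z.1‖ ^ r + ‖z.2‖ ^ r) ≤ ‖z.1 - z.2‖ ^ r
    · have h1 := hδK z ⟨by simpa using hz, h⟩
      have h2 : ‖z.1 - z.2‖ ≤ 2 := by
        linarith [norm_sub_le z.1 z.2, norm_fst_le z, norm_snd_le z]
      have h3 : ‖z.1 - z.2‖ ^ r ≤ 2 ^ r := Real.rpow_le_rpow (norm_nonneg _) h2 hr0.le
      have h4 : 2 ^ r ≤ 2 ^ r / δ * convexityDefect r z.1 z.2 := by
        calc (2 : ℝ) ^ r = 2 ^ r / δ * δ := by field_simp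
          _ ≤ _ := by gcongr
      have h5 : 0 ≤ ε * (‖z.1‖ ^ r + ‖z.2‖ ^ r) := by positivity
      linarith
    · have h1 := convexityDefect_nonneg hr.le z.1 z.2
      have h2 : 0 ≤ 2 ^ r / δ * convexityDefect r z.1 z.2 := by positivity
      linarith
  rcases eq_or_ne (a, b) 0 with h0 | h0
  · obtain ⟨rfl, rfl⟩ := Prod.mk_eq_zero.1 h0
    simp [convexityDefect, Real.zero_rpow hr0.ne']
  · set t := ‖(a, b)‖ with ht
    have ht0 : 0 < t := norm_pos_iff.2 h0
    obtain ⟨a', ha'⟩ : ∃ a', a = t • a' := ⟨t⁻¹ • a, (smul_inv_smul₀ ht0.ne' a).symm⟩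
    obtain ⟨b', hb'⟩ : ∃ b', b = t • b' := ⟨t⁻¹ • b, (smul_inv_smul₀ ht0.ne' b).symm⟩
    have hz : ‖(a', b')‖ = 1 := by
      have : t = t * ‖(a', b')‖ := by
        conv_lhs => rw [ht, ha', hb', ← Prod.smul_mk, norm_smul, Real.norm_of_nonneg ht0.le]
      exact (mul_right_inj' ht0.ne').1 (by rw [← this, mul_one])
    have h1 := mul_le_mul_of_nonneg_left (unit _ hz) (Real.rpow_nonneg ht0.le r)
    rw [ha', hb', ← smul_sub, norm_smul_rpow_of_nonneg ht0.le, norm_smul_rpow_of_nonneg ht0.le,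
      norm_smul_rpow_of_nonneg ht0.le, convexityDefect_smul ht0.le]
    linarith

end Pointwise

section Lp

variable {α E : Type*} [MeasurableSpace α] {μ : Measure α} [NormedAddCommGroup E]

theorem MeasureTheory.Lp.norm_rpow_eq_integral {p : ℝ≥0∞} (hp0 : p ≠ 0) (hp_top : p ≠ ⊤)
    (a : Lp E p μ) :
    ‖a‖ ^ p.toReal = ∫ x, ‖a x‖ ^ p.toReal ∂μ := by
  have hp : 0 < p.toReal := ENNReal.toReal_pos hp0 hp_top
  have hint : 0 ≤ ∫ x, ‖a x‖ ^ p.toReal ∂μ := integral_nonneg fun x => by positivity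
  rw [Lp.norm_def, (Lp.memLp a).eLpNorm_eq_integral_rpow_norm hp0 hp_top,
    ENNReal.toReal_ofReal (by positivity), Real.rpow_inv_rpow hint hp.ne']

/-- Uniform convexity of `‖·‖^p` on `L^p`, obtained by integrating the pointwise estimate. The
defect on the right is that of the `L^p` norm itself. -/
theorem MeasureTheory.Lp.exists_norm_sub_rpow_le [NormedSpace ℝ E] [FiniteDimensional ℝ E]
    [StrictConvexSpace ℝ E] {p : ℝ≥0∞} [Fact (1 ≤ p)] (hp : 1 < p) (hp_top : p ≠ ⊤) {ε : ℝ}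
    (hε : 0 < ε) :
    ∃ C : ℝ, 0 ≤ C ∧ ∀ a b : Lp E p μ, ‖a - b‖ ^ p.toReal ≤
      ε * (‖a‖ ^ p.toReal + ‖b‖ ^ p.toReal) + C * convexityDefect p.toReal a b := by
  have hp0 : p ≠ 0 := (zero_lt_one.trans hp).ne'
  have hr : 1 < p.toReal := by
    simpa using (ENNReal.toReal_lt_toReal ENNReal.one_ne_top hp_top).2 hp
  obtain ⟨C, hC, h⟩ := _root_.exists_norm_sub_rpow_le (E := E) hr hε
  refine ⟨C, hC, fun a b => ?_⟩
  have hi (c : Lp E p μ) : Integrable (fun x => ‖c x‖ ^ p.toReal) μ :=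
    (Lp.memLp c).integrable_norm_rpow hp0 hp_top
  have hsum : Integrable (fun x => ‖a x‖ ^ p.toReal + ‖b x‖ ^ p.toReal) μ := (hi a).add (hi b)
  have hdef : Integrable (fun x => (‖a x‖ ^ p.toReal + ‖b x‖ ^ p.toReal) / 2 -
      ‖((1 / 2 : ℝ) • (a + b)) x‖ ^ p.toReal) μ := (hsum.div_const 2).sub (hi _)
  have hrhs : ε * (‖a‖ ^ p.toReal + ‖b‖ ^ p.toReal) + C * convexityDefect p.toReal a b =
      ∫ x, ε * (‖a x‖ ^ p.toReal + ‖b x‖ ^ p.toReal) +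
        C * ((‖a x‖ ^ p.toReal + ‖b x‖ ^ p.toReal) / 2 -
          ‖((1 / 2 : ℝ) • (a + b)) x‖ ^ p.toReal) ∂μ := by
    rw [integral_add (hsum.const_mul ε) (hdef.const_mul C), integral_const_mul,
      integral_const_mul, integral_sub (hsum.div_const 2) (hi _), integral_div,
      integral_add (hi a) (hi b)]
    simp only [convexityDefect, Lp.norm_rpow_eq_integral hp0 hp_top]
  rw [hrhs, Lp.norm_rpow_eq_integral hp0 hp_top]
  refine integral_mono_ae (hi _) ((hsum.const_mul ε).add (hdef.const_mul C)) ?_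
  filter_upwards [Lp.coeFn_sub a b, Lp.coeFn_smul (1 / 2 : ℝ) (a + b), Lp.coeFn_add a b]
    with x h1 h2 h3
  have := h (a x) (b x)
  simp only [convexityDefect] at this
  rw [h1, h2, Pi.sub_apply, Pi.smul_apply, h3, Pi.add_apply]
  exact this

end Lp

/-! ### The Poincaré inequality on a strip -/

section Poincare

variable {d : ℕ} {Ω : Set (EuclideanSpace ℝ (Fin d))} {φ : EuclideanSpace ℝ (Fin d) → ℝ}

theorem IsTestFunction.continuous_gradient (h : IsTestFunction Ω φ) : Continuous (gradient φ) :=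
  (InnerProductSpace.toDual ℝ _).symm.continuous.comp (h.contDiff.continuous_fderiv (by simp))

theorem IsTestFunction.hasCompactSupport_gradient (h : IsTestFunction Ω φ) :
    HasCompactSupport (gradient φ) :=
  (h.hasCompactSupport.fderiv (𝕜 := ℝ)).comp_left
    (g := (InnerProductSpace.toDual ℝ (EuclideanSpace ℝ (Fin d))).symm) (map_zero _)

theorem norm_gradient (x : EuclideanSpace ℝ (Fin d)) : ‖gradient φ x‖ = ‖fderiv ℝ φ x‖ :=
  LinearIsometryEquiv.norm_map _ _

theorem gradient_apply_eq_partialDeriv (x : EuclideanSpace ℝ (Fin d)) (i : Fin d) :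
    gradient φ x i = partialDeriv i φ x := by
  have : inner ℝ (gradient φ x) (EuclideanSpace.single i (1 : ℝ)) = partialDeriv i φ x := by
    rw [gradient, InnerProductSpace.toDual_symm_apply]; rfl
  rw [← this, EuclideanSpace.inner_single_right]
  simp

/-- The classical gradient of a test function is its weak gradient. -/
theorem IsTestFunction.hasWeakGradient (h : IsTestFunction Ω φ) :
    HasWeakGradient Ω φ (gradient φ) := by
  intro ψ hψ i
  have hout (x) (hx : x ∉ Ω) : ψ x = 0 :=
    image_eq_zero_of_notMem_tsupport fun h' => hx (hψ.tsupport_subset h')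
  have houtφ (x) (hx : x ∉ Ω) : φ x = 0 :=
    image_eq_zero_of_notMem_tsupport fun h' => hx (h.tsupport_subset h')
  rw [setIntegral_eq_integral_of_forall_compl_eq_zero (fun x hx => by simp [houtφ x hx]),
    setIntegral_eq_integral_of_forall_compl_eq_zero (fun x hx => by simp [hout x hx])]
  simp only [gradient_apply_eq_partialDeriv]
  have c1 := h.contDiff.continuous
  have c2 := hψ.contDiff.continuous
  refine integral_mul_fderiv_eq_neg_fderiv_mul_of_integrable
    (((h.continuous_partialDeriv i).mul c2).integrable_of_hasCompactSupport
      (hψ.hasCompactSupport.mul_left))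
    ((c1.mul (hψ.continuous_partialDeriv i)).integrable_of_hasCompactSupport
      (h.hasCompactSupport.mul_right))
    ((c1.mul c2).integrable_of_hasCompactSupport (h.hasCompactSupport.mul_right))
    (fun x _ => h.contDiff.differentiable (by simp) x)
    (fun x _ => hψ.contDiff.differentiable (by simp) x)

/-- The weak gradient of an element of `W^{1,p}(Ω)` represented by a test function is the classical
gradient, because on an open set the function determines the weak gradient. -/
theorem grad_ae_eq_gradient (hΩ : IsOpen Ω) {p : ℝ≥0∞} [Fact (1 ≤ p)] {w : W1p Ω p}
    (h : IsTestFunction Ω φ) (hw : W1p.fn w =ᵐ[volume.restrict Ω] φ) :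
    W1p.grad w =ᵐ[volume.restrict Ω] gradient φ := by
  have m1 : MemLp φ p (volume.restrict Ω) :=
    (h.contDiff.continuous.memLp_of_hasCompactSupport h.hasCompactSupport).restrict Ω
  have m2 : MemLp (gradient φ) p (volume.restrict Ω) :=
    (h.continuous_gradient.memLp_of_hasCompactSupport h.hasCompactSupport_gradient).restrict Ω
  have hmem : (m1.toLp φ, m2.toLp (gradient φ)) ∈ W1p Ω p := by
    intro ψ hψ i
    have e1 : ∫ x in Ω, (m1.toLp φ) x * partialDeriv i ψ x = ∫ x in Ω, φ x * partialDeriv i ψ x :=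
      integral_congr_ae (by filter_upwards [m1.coeFn_toLp] with x hx; rw [hx])
    have e2 : ∫ x in Ω, (m2.toLp (gradient φ)) x i * ψ x = ∫ x in Ω, gradient φ x i * ψ x :=
      integral_congr_ae (by filter_upwards [m2.coeFn_toLp] with x hx; rw [hx])
    exact e1.trans ((h.hasWeakGradient ψ hψ i).trans (by rw [← e2]))
  have : w = ⟨_, hmem⟩ := W1p.ext_fn hΩ (Lp.ext (hw.trans m1.coeFn_toLp.symm))
  rw [this]
  exact m2.coeFn_toLp

/-- The core of the Poincaré inequality on a strip: `s x = ⟪e, x⟫ - a` has `∂ₑ s = 1`, and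
`0 ≤ s ≤ L` on `Ω`, so integrating `‖φ‖^r ∂ₑ s` by parts moves the derivative onto `‖φ‖^r`. -/
theorem IsTestFunction.integral_norm_rpow_le {L : ℝ} (hL0 : 0 ≤ L) {r : ℝ} (hr : 1 < r)
    {e : EuclideanSpace ℝ (Fin d)} {a : ℝ} (he : ‖e‖ = 1)
    (hs : ∀ x ∈ Ω, a ≤ inner ℝ e x ∧ inner ℝ e x ≤ a + L) (h : IsTestFunction Ω φ) :
    ∫ x, ‖φ x‖ ^ r ≤ r * L * ∫ x, ‖φ x‖ ^ (r - 1) * ‖gradient φ x‖ := by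
  have hr1 : 0 < r - 1 := by linarith
  have hφ1 : ContDiff ℝ 1 φ := h.contDiff.of_le (by simp)
  have hpow : ContDiff ℝ 1 fun x => ‖φ x‖ ^ r := hφ1.norm_rpow hr
  have hpc : HasCompactSupport fun x => ‖φ x‖ ^ r :=
    h.hasCompactSupport.comp_left (g := fun t : ℝ => ‖t‖ ^ r)
      (by simp [Real.zero_rpow (by linarith : r ≠ 0)])
  have hDc : Continuous fun x => fderiv ℝ (fun x => ‖φ x‖ ^ r) x e :=
    (hpow.continuous_fderiv (by simp)).clm_apply continuous_const
  have hDs : HasCompactSupport fun x => fderiv ℝ (fun x => ‖φ x‖ ^ r) x e :=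
    hpc.fderiv_apply (𝕜 := ℝ) _
  let s : EuclideanSpace ℝ (Fin d) → ℝ := fun x => inner ℝ e x - a
  have hsd (x) : HasFDerivAt s (innerSL ℝ e) x := (innerSL ℝ e).hasFDerivAt.sub_const a
  have hse (x) : fderiv ℝ s x e = 1 := by
    rw [(hsd x).fderiv, innerSL_apply_apply, real_inner_self_eq_norm_sq, he]; norm_num
  have hsc : Continuous s := by fun_prop
  have ibp : ∫ x, ‖φ x‖ ^ r * fderiv ℝ s x e =
      - ∫ x, fderiv ℝ (fun x => ‖φ x‖ ^ r) x e * s x := by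
    refine integral_mul_fderiv_eq_neg_fderiv_mul_of_integrable
      ((hDc.mul hsc).integrable_of_hasCompactSupport hDs.mul_right) ?_
      ((hpow.continuous.mul hsc).integrable_of_hasCompactSupport hpc.mul_right)
      (fun x _ => hpow.differentiable (by simp) x) (fun x _ => (hsd x).differentiableAt)
    simp only [hse, mul_one]
    exact hpow.continuous.integrable_of_hasCompactSupport hpc
  simp only [hse, mul_one] at ibp
  rw [ibp, ← integral_neg, ← integral_const_mul]
  refine integral_mono ((hDc.mul hsc).integrable_of_hasCompactSupport hDs.mul_right).neg ?_ ?_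
  · refine (((h.contDiff.continuous.norm.rpow_const fun _ => Or.inr hr1.le).mul
      h.continuous_gradient.norm).integrable_of_hasCompactSupport
        h.hasCompactSupport_gradient.norm.mul_left).const_mul _
  · intro x
    have hD : |fderiv ℝ (fun x => ‖φ x‖ ^ r) x e| ≤ r * ‖φ x‖ ^ (r - 1) * ‖gradient φ x‖ := by
      have h1 := (fderiv ℝ (fun x => ‖φ x‖ ^ r) x).le_opNorm e
      rw [he, mul_one] at h1
      rw [norm_gradient]
      exact h1.trans (norm_fderiv_norm_rpow_le (hφ1.differentiable (by simp)) hr)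
    change -(fderiv ℝ (fun x => ‖φ x‖ ^ r) x e * s x) ≤ _
    refine (neg_le_abs _).trans ?_
    rw [abs_mul]
    by_cases hx : x ∈ Ω
    · have h2 : |s x| ≤ L := by
        have := hs x hx
        rw [abs_le]; constructor <;> simp only [s] <;> linarith
      calc _ ≤ (r * ‖φ x‖ ^ (r - 1) * ‖gradient φ x‖) * L := by gcongr
        _ = _ := by ring
    · have h0 : φ x = 0 := image_eq_zero_of_notMem_tsupport fun h' => hx (h.tsupport_subset h')
      rw [h0, norm_zero, Real.zero_rpow hr1.ne'] at hD
      have : |fderiv ℝ (fun x => ‖φ x‖ ^ r) x e| = 0 :=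
        le_antisymm (by simpa using hD) (abs_nonneg _)
      rw [this, zero_mul]
      positivity

/-- The Poincaré inequality `‖φ‖_r ≤ r L ‖∇φ‖_r` for test functions on a set inside a strip. -/
theorem IsTestFunction.rpow_integral_norm_rpow_le {L : ℝ} (hL0 : 0 ≤ L) {r : ℝ} (hr : 1 < r)
    {e : EuclideanSpace ℝ (Fin d)} {a : ℝ} (he : ‖e‖ = 1)
    (hs : ∀ x ∈ Ω, a ≤ inner ℝ e x ∧ inner ℝ e x ≤ a + L) (h : IsTestFunction Ω φ) :
    (∫ x, ‖φ x‖ ^ r) ^ r⁻¹ ≤ r * L * (∫ x, ‖gradient φ x‖ ^ r) ^ r⁻¹ := by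
  have hr0 : 0 < r := by linarith
  have hr1 : 0 < r - 1 := by linarith
  have hB : 0 ≤ ∫ x, ‖gradient φ x‖ ^ r := integral_nonneg fun x => by positivity
  have hA0 : 0 ≤ ∫ x, ‖φ x‖ ^ r := integral_nonneg fun x => by positivity
  rcases hA0.eq_or_lt with hA | hA
  · rw [← hA, Real.zero_rpow (inv_ne_zero hr0.ne')]
    exact mul_nonneg (mul_nonneg hr0.le hL0) (Real.rpow_nonneg hB _)
  have hconj : (Real.conjExponent r).HolderConjugate r := (Real.HolderConjugate.conjExponent hr).symm
  have hexp : (r - 1) * Real.conjExponent r = r := by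
    rw [Real.conjExponent]; field_simp
  have h1 := h.integral_norm_rpow_le hL0 hr he hs
  have h2 : ∫ x, ‖φ x‖ ^ (r - 1) * ‖gradient φ x‖ ≤
      (∫ x, ‖φ x‖ ^ r) ^ (1 / Real.conjExponent r) * (∫ x, ‖gradient φ x‖ ^ r) ^ (1 / r) := by
    have := integral_mul_le_Lp_mul_Lq_of_nonneg (μ := volume) hconj
      (f := fun x => ‖φ x‖ ^ (r - 1)) (g := fun x => ‖gradient φ x‖)
      (.of_forall fun x => by positivity) (.of_forall fun x => by positivity)
      ((h.contDiff.continuous.norm.rpow_const fun _ => Or.inr hr1.le).memLp_of_hasCompactSupport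
        (h.hasCompactSupport.comp_left (g := fun t : ℝ => ‖t‖ ^ (r - 1))
          (by simp [Real.zero_rpow hr1.ne'])))
      (h.continuous_gradient.norm.memLp_of_hasCompactSupport h.hasCompactSupport_gradient.norm)
    simpa only [← Real.rpow_mul (norm_nonneg _), hexp] using this
  set A := ∫ x, ‖φ x‖ ^ r
  set B := ∫ x, ‖gradient φ x‖ ^ r
  have h3 : A ^ r⁻¹ * A ^ (1 / Real.conjExponent r) = A := by
    rw [← Real.rpow_add hA, ← one_div, add_comm]
    have := hconj.inv_add_inv_eq_one
    rw [one_div, one_div, this, Real.rpow_one]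
  have h4 : 0 < A ^ (1 / Real.conjExponent r) := Real.rpow_pos_of_pos hA _
  refine le_of_mul_le_mul_right ?_ h4
  rw [h3]
  calc A ≤ r * L * (A ^ (1 / Real.conjExponent r) * B ^ (1 / r)) := h1.trans (by gcongr)
    _ = _ := by rw [one_div r]; ring

/-- The norm in `L^p(s)` of a class represented by a function that vanishes outside `s`, as an
integral over the whole space. -/
theorem MeasureTheory.Lp.norm_eq_rpow_integral_of_ae_eq {α E : Type*} [MeasurableSpace α]
    {μ : Measure α}
    [NormedAddCommGroup E] {s : Set α} {p : ℝ≥0∞} [Fact (1 ≤ p)]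
    (hp_top : p ≠ ⊤) {w : Lp E p (μ.restrict s)} {ψ : α → E} (hw : w =ᵐ[μ.restrict s] ψ)
    (hψ : ∀ x ∉ s, ψ x = 0) :
    ‖w‖ = (∫ x, ‖ψ x‖ ^ p.toReal ∂μ) ^ p.toReal⁻¹ := by
  have hp0 : p ≠ 0 := (zero_lt_one.trans_le (Fact.out : 1 ≤ p)).ne'
  have h0 : p.toReal ≠ 0 := (ENNReal.toReal_pos hp0 hp_top).ne'
  have h1 : ∫ x, ‖ψ x‖ ^ p.toReal ∂μ = ∫ x in s, ‖ψ x‖ ^ p.toReal ∂μ :=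
    (setIntegral_eq_integral_of_forall_compl_eq_zero fun x hx => by
      rw [hψ x hx, _root_.norm_zero, Real.zero_rpow h0]).symm
  rw [← Real.rpow_rpow_inv (norm_nonneg w) h0, Lp.norm_rpow_eq_integral hp0 hp_top, h1]
  congr 1
  exact integral_congr_ae (by filter_upwards [hw] with x hx; rw [hx])

theorem W1p.norm_fn_le_of_mem_testSubspace (hΩ : IsOpen Ω) {L : ℝ} (hL0 : 0 ≤ L) {p : ℝ≥0∞}
    [Fact (1 ≤ p)] (hp : 1 < p) (hp_top : p ≠ ⊤)
    {e : EuclideanSpace ℝ (Fin d)} {a : ℝ} (he : ‖e‖ = 1)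
    (hs : ∀ x ∈ Ω, a ≤ inner ℝ e x ∧ inner ℝ e x ≤ a + L) {w : W1p Ω p}
    (hw : w ∈ testSubspace Ω p) :
    ‖W1p.fn w‖ ≤ p.toReal * L * ‖W1p.grad w‖ := by
  obtain ⟨φ, h, hwφ⟩ := hw
  have hp0 : p ≠ 0 := (zero_lt_one.trans hp).ne'
  have hr : 1 < p.toReal := by
    simpa using (ENNReal.toReal_lt_toReal ENNReal.one_ne_top hp_top).2 hp
  have hg := grad_ae_eq_gradient hΩ h hwφ
  have key := h.rpow_integral_norm_rpow_le hL0 hr he hs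
  rw [Lp.norm_eq_rpow_integral_of_ae_eq hp_top hwφ fun x hx =>
      image_eq_zero_of_notMem_tsupport fun h' => hx (h.tsupport_subset h'),
    Lp.norm_eq_rpow_integral_of_ae_eq hp_top hg fun x hx => by
      rw [← norm_eq_zero, norm_gradient, image_eq_zero_of_notMem_tsupport
        (fun h' => hx (h.tsupport_subset (tsupport_fderiv_subset ℝ h'))), norm_zero]]
  exact key

theorem W1p.continuous_fn {p : ℝ≥0∞} [Fact (1 ≤ p)] :
    Continuous (W1p.fn : W1p Ω p → Lp ℝ p (volume.restrict Ω)) :=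
  continuous_fst.comp continuous_subtype_val

theorem W1p.continuous_grad {p : ℝ≥0∞} [Fact (1 ≤ p)] :
    Continuous (W1p.grad : W1p Ω p → Lp (EuclideanSpace ℝ (Fin d)) p (volume.restrict Ω)) :=
  continuous_snd.comp continuous_subtype_val

/-- The Poincaré inequality on `W_0^{1,p}(Ω)`. Both sides are continuous in `W^{1,p}(Ω)`, so it passes
from test functions to their closure. -/
theorem FitsInStrip.exists_norm_fn_le {L : ℝ} (hL : FitsInStrip Ω L) (hΩ : IsOpen Ω) {p : ℝ≥0∞}
    [Fact (1 ≤ p)] (hp : 1 < p) (hp_top : p ≠ ⊤) :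
    ∃ C : ℝ, ∀ w ∈ W10p Ω p, ‖W1p.fn w‖ ≤ C * ‖W1p.grad w‖ := by
  obtain ⟨e, a, he, hs⟩ := hL
  -- The width may be negative if `Ω` is empty, whence `|L|`.
  have hs' : ∀ x ∈ Ω, a ≤ inner ℝ e x ∧ inner ℝ e x ≤ a + |L| := fun x hx =>
    ⟨(hs x hx).1, (hs x hx).2.trans (by linarith [le_abs_self L])⟩
  refine ⟨p.toReal * |L|, fun w hw => ?_⟩
  have hcl : IsClosed {w : W1p Ω p | ‖W1p.fn w‖ ≤ p.toReal * |L| * ‖W1p.grad w‖} :=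
    isClosed_le W1p.continuous_fn.norm (W1p.continuous_grad.norm.const_mul _)
  exact closure_minimal (fun v hv => W1p.norm_fn_le_of_mem_testSubspace hΩ (abs_nonneg L) hp hp_top
    he hs' hv) hcl hw

end Poincare

/-! ### Completeness of `W^{1,p}` -/

section Complete

variable {d : ℕ} {Ω : Set (EuclideanSpace ℝ (Fin d))} {p q : ℝ≥0∞} [Fact (1 ≤ p)]

/-- By Hölder's inequality, pairing with an element of `L^q` is a continuous linear functional on
`L^p`. -/
theorem exists_clm_eq_integral_mul (hpq : p⁻¹ + q⁻¹ = 1) {α : Type*} [MeasurableSpace α]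
    {μ : Measure α} (f : Lp ℝ q μ) :
    ∃ T : Lp ℝ p μ →L[ℝ] ℝ, ∀ u, T u = ∫ x, f x * u x ∂μ := by
  have : ENNReal.HolderConjugate q p := ⟨by rw [add_comm, hpq, inv_one]⟩
  have : Fact (1 ≤ q) := ⟨ENNReal.HolderConjugate.one_le q p⟩
  exact ⟨(ContinuousLinearMap.mul ℝ ℝ).lpPairing μ q p f, fun u => by
    rw [ContinuousLinearMap.lpPairing_eq_integral]; simp⟩

/-- Weak gradients pass to the limit in `L^p`, since both sides of the defining identity are pairings
with test functions, which lie in `L^q`. -/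
theorem W1p.isClosed (hpq : p⁻¹ + q⁻¹ = 1) :
    IsClosed (W1p Ω p : Set (Lp ℝ p (volume.restrict Ω) ×
      Lp (EuclideanSpace ℝ (Fin d)) p (volume.restrict Ω))) := by
  have key (ψ : EuclideanSpace ℝ (Fin d) → ℝ) (hc : Continuous ψ) (hs : HasCompactSupport ψ) :
      Continuous fun u : Lp ℝ p (volume.restrict Ω) => ∫ x in Ω, u x * ψ x := by
    have m : MemLp ψ q (volume.restrict Ω) := (hc.memLp_of_hasCompactSupport hs).restrict Ω
    obtain ⟨T, hT⟩ := exists_clm_eq_integral_mul hpq m.toLp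
    refine T.continuous.congr fun u => ?_
    rw [hT]
    exact integral_congr_ae (by filter_upwards [m.coeFn_toLp] with x hx; rw [hx, mul_comm])
  have : (W1p Ω p : Set (Lp ℝ p (volume.restrict Ω) ×
      Lp (EuclideanSpace ℝ (Fin d)) p (volume.restrict Ω))) =
      ⋂ (φ) (_ : IsTestFunction Ω φ) (i : Fin d), {w | ∫ x in Ω, w.1 x * partialDeriv i φ x =
        - ∫ x in Ω, w.2 x i * φ x} := by
    ext w
    simp only [mem_iInter, mem_ofPred_eq]
    rfl
  rw [this]
  refine isClosed_iInter fun φ => isClosed_iInter fun h => isClosed_iInter fun i => ?_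
  refine isClosed_eq ((key _ (h.continuous_partialDeriv i)
    (h.hasCompactSupport_partialDeriv i)).comp continuous_fst) (Continuous.neg ?_)
  let P : EuclideanSpace ℝ (Fin d) →L[ℝ] ℝ := EuclideanSpace.proj i
  refine ((key φ h.contDiff.continuous h.hasCompactSupport).comp
    ((P.compLpL p (volume.restrict Ω)).continuous.comp continuous_snd)).congr fun w => ?_
  refine integral_congr_ae ?_
  filter_upwards [P.coeFn_compLpL w.2] with x hx
  simp only [Function.comp_apply, hx]
  rfl

theorem W1p.completeSpace (hpq : p⁻¹ + q⁻¹ = 1) : CompleteSpace (W1p Ω p) :=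
  (W1p.isClosed hpq).completeSpace_coe

end Complete

/-! ### Powers of a seminorm minus a linear functional -/

section AbstractEnergy

variable {X Y : Type*} [NormedAddCommGroup X] [NormedSpace ℝ X] [NormedAddCommGroup Y]
  [NormedSpace ℝ Y] {r : ℝ}

/-- The functional `u ↦ (1/r) ‖G u + y‖^r - T u`. The `p`-Laplace energy is of this form with
`r = p`, `G` the weak gradient, `y = ∇g` and `T u = ∫ f u`. -/
noncomputable def normRpowEnergy (r : ℝ) (G : X →L[ℝ] Y) (y : Y) (T : X →L[ℝ] ℝ) (u : X) : ℝ :=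
  1 / r * ‖G u + y‖ ^ r - T u

theorem continuous_normRpowEnergy (hr : 0 ≤ r) (G : X →L[ℝ] Y) (y : Y) (T : X →L[ℝ] ℝ) :
    Continuous (normRpowEnergy r G y T) :=
  (((G.continuous.add continuous_const).norm.rpow_const fun _ => Or.inr hr).const_mul _).sub
    T.continuous

/-- Coercivity: the linear term is at most linear in `‖G w‖`, so Young's inequality absorbs it into
the `r`-th power and still leaves a term `‖G w + y‖`. -/
theorem exists_norm_sub_le_normRpowEnergy (hr : 1 < r) (G : X →L[ℝ] Y) (y : Y) (T : X →L[ℝ] ℝ)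
    {V : Set X} {M : ℝ} (hM0 : 0 ≤ M) (hM : ∀ w ∈ V, ‖w‖ ≤ M * ‖G w‖) :
    ∃ B : ℝ, ∀ w ∈ V, ‖G w + y‖ - B ≤ normRpowEnergy r G y T w := by
  set K := ‖T‖ * M with hK
  have hK0 : 0 ≤ K := by positivity
  refine ⟨(K + 1) ^ Real.conjExponent r / Real.conjExponent r + K * ‖y‖, fun w hw => ?_⟩
  have h1 : T w ≤ K * (‖G w + y‖ + ‖y‖) := by
    have h2 : ‖G w‖ ≤ ‖G w + y‖ + ‖y‖ := by
      simpa using norm_sub_le (G w + y) y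
    calc T w ≤ ‖T‖ * ‖w‖ := (le_abs_self _).trans (T.le_opNorm _)
      _ ≤ ‖T‖ * (M * (‖G w + y‖ + ‖y‖)) := by
        gcongr
        exact (hM w hw).trans (by gcongr)
      _ = _ := by rw [hK]; ring
  -- The factor `K + 1` instead of `K` leaves `‖G w + y‖` over in the lower bound.
  have h3 := Real.young_inequality_of_nonneg (norm_nonneg (G w + y))
    (by positivity : 0 ≤ K + 1) (Real.HolderConjugate.conjExponent hr)
  rw [normRpowEnergy, one_div_mul_eq_div]
  linarith

/-- The linear part of the energy cancels in its midpoint convexity defect. -/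
theorem convexityDefect_eq_normRpowEnergy (hr : r ≠ 0) (G : X →L[ℝ] Y) (y : Y) (T : X →L[ℝ] ℝ)
    (u v : X) :
    convexityDefect r (G u + y) (G v + y) =
      r * ((normRpowEnergy r G y T u + normRpowEnergy r G y T v) / 2 -
        normRpowEnergy r G y T ((1 / 2 : ℝ) • (u + v))) := by
  have h1 : (1 / 2 : ℝ) • ((G u + y) + (G v + y)) = G ((1 / 2 : ℝ) • (u + v)) + y := by
    rw [map_smul, map_add]
    module
  have h2 : T ((1 / 2 : ℝ) • (u + v)) = (T u + T v) / 2 := by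
    rw [map_smul, map_add, smul_eq_mul]
    ring
  rw [convexityDefect, h1, normRpowEnergy, normRpowEnergy, normRpowEnergy, h2]
  field_simp
  ring

/-- If `‖·‖^r` is uniformly convex on `Y` in the sense of `hY`, and `‖G ·‖` controls the norm on the
closed subspace `V`, then `normRpowEnergy` has exactly one minimizer over `V`: the midpoint of two
near-minimizers is in `V`, so their convexity defect is small, and hence so is their distance. -/
theorem existsUnique_normRpowEnergy_le [CompleteSpace X] (hr : 1 < r)
    (hY : ∀ ε > 0, ∃ D : ℝ, 0 ≤ D ∧ ∀ a b : Y,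
      ‖a - b‖ ^ r ≤ ε * (‖a‖ ^ r + ‖b‖ ^ r) + D * convexityDefect r a b)
    (G : X →L[ℝ] Y) (y : Y) (T : X →L[ℝ] ℝ) {V : Submodule ℝ X} (hV : IsClosed (V : Set X))
    {M : ℝ} (hM0 : 0 < M) (hM : ∀ w ∈ V, ‖w‖ ≤ M * ‖G w‖) :
    ∃! u : X, u ∈ V ∧ ∀ v ∈ V, normRpowEnergy r G y T u ≤ normRpowEnergy r G y T v := by
  have hr0 : 0 < r := by linarith
  obtain ⟨B, hB⟩ := exists_norm_sub_le_normRpowEnergy hr G y T hM0.le hM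
  have hbdd : BddBelow (normRpowEnergy r G y T '' (V : Set X)) := by
    refine ⟨-B, ?_⟩
    rintro _ ⟨w, hw, rfl⟩
    linarith [hB w hw, norm_nonneg (G w + y)]
  refine existsUnique_isMinOn_of_dist_le hV ⟨0, V.zero_mem⟩
    (continuous_normRpowEnergy hr0.le G y T) hbdd fun ε hε => ?_
  set m := sInf (normRpowEnergy r G y T '' (V : Set X)) with hm
  set R := |m + 1 + B| with hR
  set η := ε / M with hη
  have hη0 : 0 < η := by positivity
  have hηr : 0 < η ^ r := Real.rpow_pos_of_pos hη0 r
  have hRr : 0 ≤ R ^ r := Real.rpow_nonneg (abs_nonneg _) r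
  -- Near-minimizers `w` have `‖G w + y‖ ≤ R`, so this choice makes the first term of `hY` at most
  -- `η ^ r / 2`; the choice of `δ` below does the same for the second.
  obtain ⟨D, hD0, hD⟩ := hY (η ^ r / (4 * (R ^ r + 1))) (by positivity)
  refine ⟨min 1 (η ^ r / (2 * r * (D + 1))), by positivity, fun u hu v hv hJu hJv => ?_⟩
  set δ := min 1 (η ^ r / (2 * r * (D + 1))) with hδ
  have hδ1 : δ ≤ 1 := min_le_left _ _
  have hN (w) (hw : w ∈ V) (hJ : normRpowEnergy r G y T w ≤ m + δ) :
      ‖G w + y‖ ^ r ≤ R ^ r := by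
    refine Real.rpow_le_rpow (norm_nonneg _) ?_ hr0.le
    have h1 := hB w hw
    have h2 := le_abs_self (m + 1 + B)
    linarith
  -- The energy at the midpoint is at least `m`, and both energies are at most `m + δ`.
  have hdef : convexityDefect r (G u + y) (G v + y) ≤ r * δ := by
    rw [convexityDefect_eq_normRpowEnergy hr0.ne' G y T]
    have hmid : m ≤ normRpowEnergy r G y T ((1 / 2 : ℝ) • (u + v)) :=
      csInf_le hbdd (mem_image_of_mem _ (V.smul_mem _ (V.add_mem hu hv)))
    gcongr
    linarith
  have hsub : (G u + y) - (G v + y) = G (u - v) := by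
    rw [add_sub_add_right_eq_sub, map_sub]
  have hgrad : ‖G (u - v)‖ ≤ η := by
    rw [← Real.rpow_le_rpow_iff (norm_nonneg _) hη0.le hr0, ← hsub]
    refine (hD _ _).trans ?_
    have h1 : η ^ r / (4 * (R ^ r + 1)) * (‖G u + y‖ ^ r + ‖G v + y‖ ^ r) ≤ η ^ r / 2 := by
      calc _ ≤ η ^ r / (4 * (R ^ r + 1)) * (2 * (R ^ r + 1)) := by
            gcongr
            linarith [hN u hu hJu, hN v hv hJv]
        _ = η ^ r / 2 := by field_simp; norm_num
    have h2 : D * convexityDefect r (G u + y) (G v + y) ≤ η ^ r / 2 := by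
      calc _ ≤ (D + 1) * (r * (η ^ r / (2 * r * (D + 1)))) := by
            have := convexityDefect_nonneg hr.le (G u + y) (G v + y)
            have h3 : r * δ ≤ r * (η ^ r / (2 * r * (D + 1))) := by
              gcongr; exact min_le_right _ _
            exact mul_le_mul (by linarith) (hdef.trans h3) this (by linarith)
        _ = η ^ r / 2 := by field_simp
    linarith
  rw [dist_eq_norm]
  calc ‖u - v‖ ≤ M * ‖G (u - v)‖ := hM _ (V.sub_mem hu hv)
    _ ≤ M * η := by gcongr
    _ = ε := by rw [hη]; field_simp

end AbstractEnergy

/-! ### The `p`-Laplace energy -/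

section Energy

variable {d : ℕ} {Ω : Set (EuclideanSpace ℝ (Fin d))} {p q : ℝ≥0∞} [Fact (1 ≤ p)]

/-- `W1p.fn` as a continuous linear map. -/
noncomputable def W1p.fnCLM (Ω : Set (EuclideanSpace ℝ (Fin d))) (p : ℝ≥0∞) [Fact (1 ≤ p)] :
    W1p Ω p →L[ℝ] Lp ℝ p (volume.restrict Ω) :=
  (ContinuousLinearMap.fst ℝ _ _).comp (W1p Ω p).subtypeL

/-- `W1p.grad` as a continuous linear map. -/
noncomputable def W1p.gradCLM (Ω : Set (EuclideanSpace ℝ (Fin d))) (p : ℝ≥0∞) [Fact (1 ≤ p)] :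
    W1p Ω p →L[ℝ] Lp (EuclideanSpace ℝ (Fin d)) p (volume.restrict Ω) :=
  (ContinuousLinearMap.snd ℝ _ _).comp (W1p Ω p).subtypeL

theorem W1p.norm_eq_max (u : W1p Ω p) : ‖u‖ = max ‖W1p.fn u‖ ‖W1p.grad u‖ := rfl

theorem pLaplaceEnergy_eq_normRpowEnergy (hp_top : p ≠ ⊤) {f : Lp ℝ q (volume.restrict Ω)}
    {T : Lp ℝ p (volume.restrict Ω) →L[ℝ] ℝ} (hT : ∀ u, T u = ∫ x in Ω, f x * u x)
    (g u : W1p Ω p) :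
    pLaplaceEnergy f g u = normRpowEnergy p.toReal (W1p.gradCLM Ω p) (W1p.grad g)
      (T.comp (W1p.fnCLM Ω p)) u := by
  have hp0 : p ≠ 0 := (zero_lt_one.trans_le (Fact.out : 1 ≤ p)).ne'
  rw [pLaplaceEnergy, ← Lp.norm_rpow_eq_integral hp0 hp_top, ← hT]
  rfl

theorem existsUnique_pLaplaceEnergy_le (hp : 1 < p) (hp_top : p ≠ ⊤) (hpq : p⁻¹ + q⁻¹ = 1)
    (f : Lp ℝ q (volume.restrict Ω)) (g : W1p Ω p) {V : Submodule ℝ (W1p Ω p)}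
    (hV : IsClosed (V : Set (W1p Ω p))) {C : ℝ}
    (hC : ∀ w ∈ V, ‖W1p.fn w‖ ≤ C * ‖W1p.grad w‖) :
    ∃! u : W1p Ω p, u ∈ V ∧ ∀ v ∈ V, pLaplaceEnergy f g u ≤ pLaplaceEnergy f g v := by
  have : CompleteSpace (W1p Ω p) := W1p.completeSpace hpq
  have hr : 1 < p.toReal := by
    simpa using (ENNReal.toReal_lt_toReal ENNReal.one_ne_top hp_top).2 hp
  obtain ⟨T, hT⟩ := exists_clm_eq_integral_mul hpq f
  simp only [pLaplaceEnergy_eq_normRpowEnergy hp_top hT g]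
  refine existsUnique_normRpowEnergy_le hr
    (fun ε hε => Lp.exists_norm_sub_rpow_le hp hp_top hε) _ _ _ hV
    (lt_max_of_lt_right one_pos : 0 < max C 1) fun w hw => ?_
  rw [W1p.norm_eq_max]
  change _ ≤ max C 1 * ‖W1p.grad w‖
  refine max_le ((hC w hw).trans ?_) ?_
  · gcongr
    exact le_max_left _ _
  · exact le_mul_of_one_le_left (norm_nonneg _) (le_max_right _ _)

end Energy

theorem lemma4 {d : ℕ} (Ω : Set (EuclideanSpace ℝ (Fin d))) (hΩ : IsOpen Ω)
    (L : ℝ) (hL : FitsInStrip Ω L)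
    (p q : ℝ≥0∞) [Fact (1 ≤ p)] (hp : 1 < p) (hp_top : p ≠ ⊤) (hpq : p⁻¹ + q⁻¹ = 1)
    (f : Lp ℝ q (volume.restrict Ω)) (g : W1p Ω p) :
    (∃! u : W1p Ω p, u ∈ W10p Ω p ∧ ∀ v ∈ W10p Ω p, pLaplaceEnergy f g u ≤ pLaplaceEnergy f g v) ∧
    (∀ V : Submodule ℝ (W1p Ω p), V ≤ W10p Ω p → IsClosed (V : Set (W1p Ω p)) →
      ∃! u : W1p Ω p, u ∈ V ∧ ∀ v ∈ V, pLaplaceEnergy f g u ≤ pLaplaceEnergy f g v) := by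
  obtain ⟨C, hC⟩ := hL.exists_norm_fn_le hΩ hp hp_top
  have key : ∀ V : Submodule ℝ (W1p Ω p), V ≤ W10p Ω p → IsClosed (V : Set (W1p Ω p)) →
      ∃! u : W1p Ω p, u ∈ V ∧ ∀ v ∈ V, pLaplaceEnergy f g u ≤ pLaplaceEnergy f g v :=
    fun V hV hcl => existsUnique_pLaplaceEnergy_le hp hp_top hpq f g hcl
      fun w hw => hC w (hV hw)
  exact ⟨key _ le_rfl (Submodule.isClosed_topologicalClosure _), key⟩
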